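/- Let $C^\infty(\mathbb{C})$ be the space of complex-valued functions on $\mathbb{C}$ that are infinitely differentiable in the real sense, with the topology of uniform convergence of all derivatives on compact sets. Let $u$ be a compactly supported distribution on $\mathbb{C}$, that is, a continuous complex-linear functional $\psi\mapsto\langle u,\psi\rangle$ on $C^\infty(\mathbb{C})$. Call $u$ weakly multiplicative if $$\langle u,f\overline{g}\rangle=\langle u,f\rangle\,\langle u,\overline{g}\rangle$$ for every pair of entire functions $f,g$. Write $\partial=\tfrac12(\partial_x-i\partial_y)$ and $\overline{\partial}=\tfrac12(\partial_x+i\partial_y)$, acting on distributions by $\langle\partial_x u,\psi\rangle=-\langle u,\partial_x\psi\rangle$ and $\langle\partial_y u,\psi\rangle=-\langle u,\partial_y\psi\rangle$, and let $\delta_a$ be the Dirac distribution $\langle\delta_a,\psi\rangle=\psi(a)$. Then $u$ is weakly multiplicative if and only if either $u=0$, or $u=p(\partial)\,q(\overline{\partial})\,\delta_a$ for some $a\in\mathbb{C}$ and some complex polynomials $p,q$ with $p(0)=q(0)=1$. Moreover, whenever $u=p(\partial)\,q(\overline{\partial})\,\delta_a$ with $a\in\mathbb{C}$ and $p(0)=q(0)=1$,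 the support of $u$ is exactly $\{a\}$; in particular, every non-zero weakly multiplicative $u$ is supported at a single point. -/

import Mathlib

open scoped ContDiff Polynomial

noncomputable section

/-- The space `C^∞(ℂ)` of complex-valued functions on `ℂ` that are smooth in the real sense.
It is a type of its own, so that it does not inherit the topology of pointwise convergence. -/
def SmoothFun : Type := {f : ℂ → ℂ // ContDiff ℝ ∞ f}

namespace SmoothFun

instance : FunLike SmoothFun ℂ ℂ where
  coe f := f.1
  coe_injective _ _ h := Subtype.ext h

theorem contDiff (f : SmoothFun) : ContDiff ℝ ∞ (f : ℂ → ℂ) := f.2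

/-- The smooth functions as a complex subspace of all functions, for the algebraic operations. -/
def submodule : Submodule ℂ (ℂ → ℂ) where
  carrier := {f | ContDiff ℝ ∞ f}
  add_mem' := fun {f g} (hf : ContDiff ℝ ∞ f) (hg : ContDiff ℝ ∞ g) => hf.add hg
  zero_mem' := (contDiff_const : ContDiff ℝ ∞ fun _ : ℂ => (0 : ℂ))
  smul_mem' := fun c f (hf : ContDiff ℝ ∞ f) => hf.const_smul c

instance : AddCommGroup SmoothFun := inferInstanceAs (AddCommGroup submodule)

instance : Module ℂ SmoothFun := inferInstanceAs (Module ℂ submodule)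

@[ext] theorem ext {f g : SmoothFun} (h : ∀ z, f z = g z) : f = g := DFunLike.ext f g h

theorem coe_add (f g : SmoothFun) : ((f + g : SmoothFun) : ℂ → ℂ) =
    (f : ℂ → ℂ) + (g : ℂ → ℂ) := rfl

theorem coe_smul (c : ℂ) (f : SmoothFun) : ((c • f : SmoothFun) : ℂ → ℂ) = c • (f : ℂ → ℂ) := rfl

theorem continuous_iteratedFDeriv (f : SmoothFun) (n : ℕ) :
    Continuous (iteratedFDeriv ℝ n (f : ℂ → ℂ)) :=
  f.contDiff.continuous_iteratedFDeriv (by exact_mod_cast le_top)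

theorem bddAbove_range (f : SmoothFun) (K : TopologicalSpace.Compacts ℂ) (n : ℕ) :
    BddAbove (Set.range fun z : K => ‖iteratedFDeriv ℝ n (f : ℂ → ℂ) z‖) := by
  have h := K.isCompact.bddAbove_image (f.continuous_iteratedFDeriv n).norm.continuousOn
  rw [Set.image_eq_range] at h
  exact h

/-- The seminorm `f ↦ sup_{z ∈ K} ‖D^n f(z)‖`, for `K` compact and `n` a natural number. -/
def supSeminorm (i : TopologicalSpace.Compacts ℂ × ℕ) : Seminorm ℂ SmoothFun :=
  Seminorm.of (fun f => ⨆ z : i.1, ‖iteratedFDeriv ℝ i.2 (f : ℂ → ℂ) z‖)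
    (fun f g => by
      refine Real.iSup_le (fun z => ?_) (add_nonneg
        (Real.iSup_nonneg fun _ => norm_nonneg _) (Real.iSup_nonneg fun _ => norm_nonneg _))
      have hn : ((i.2 : ℕ) : WithTop ℕ∞) ≤ ∞ := by exact_mod_cast le_top
      rw [coe_add, iteratedFDeriv_add_apply (f.contDiff.of_le hn).contDiffAt
        (g.contDiff.of_le hn).contDiffAt]
      exact (norm_add_le _ _).trans (add_le_add (le_ciSup (f.bddAbove_range i.1 i.2) z)
        (le_ciSup (g.bddAbove_range i.1 i.2) z)))
    (fun c f => by
      have hn : ((i.2 : ℕ) : WithTop ℕ∞) ≤ ∞ := by exact_mod_cast le_top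
      rw [coe_smul, Real.mul_iSup_of_nonneg (norm_nonneg c)]
      congr 1
      funext z
      rw [iteratedFDeriv_const_smul_apply (f.contDiff.of_le hn).contDiffAt, norm_smul])

theorem supSeminorm_apply (i : TopologicalSpace.Compacts ℂ × ℕ) (f : SmoothFun) :
    supSeminorm i f = ⨆ z : i.1, ‖iteratedFDeriv ℝ i.2 (f : ℂ → ℂ) z‖ := rfl

/-- The family of all the seminorms `sup_K ‖D^n f‖`. -/
def seminormFamily : SeminormFamily ℂ SmoothFun (TopologicalSpace.Compacts ℂ × ℕ) := supSeminorm

/-- The topology of uniform convergence of all derivatives on compact sets. -/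
instance : TopologicalSpace SmoothFun := seminormFamily.moduleFilterBasis.topology'

theorem withSeminorms : WithSeminorms seminormFamily := ⟨rfl⟩

instance : IsTopologicalAddGroup SmoothFun := withSeminorms.topologicalAddGroup

instance : ContinuousSMul ℂ SmoothFun := withSeminorms.continuousSMul

/-- The derivative of a smooth function in the real direction `v`, as a linear map. -/
def lineDerivₗ (v : ℂ) : SmoothFun →ₗ[ℂ] SmoothFun where
  toFun f := ⟨fun z => fderiv ℝ (f : ℂ → ℂ) z v,
    (f.contDiff.fderiv_right (m := ∞) (by simp)).clm_apply contDiff_const⟩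
  map_add' f g := by
    apply SmoothFun.ext
    intro z
    change fderiv ℝ ((f : ℂ → ℂ) + (g : ℂ → ℂ)) z v = fderiv ℝ f z v + fderiv ℝ g z v
    rw [fderiv_add (f.contDiff.differentiable (by simp) z) (g.contDiff.differentiable (by simp) z)]
    rfl
  map_smul' c f := by
    apply SmoothFun.ext
    intro z
    change fderiv ℝ (c • (f : ℂ → ℂ)) z v = c • fderiv ℝ f z v
    rw [fderiv_const_smul (f.contDiff.differentiable (by simp) z)]
    rfl

theorem supSeminorm_lineDerivₗ_le (v : ℂ) (K : TopologicalSpace.Compacts ℂ) (n : ℕ)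
    (f : SmoothFun) :
    supSeminorm (K, n) (lineDerivₗ v f) ≤ ‖v‖ * supSeminorm (K, n + 1) f := by
  rw [supSeminorm_apply, supSeminorm_apply]
  refine Real.iSup_le (fun z => ?_)
    (mul_nonneg (norm_nonneg v) (Real.iSup_nonneg fun _ => norm_nonneg _))
  have hd : ContDiff ℝ ∞ (fderiv ℝ (f : ℂ → ℂ)) := f.contDiff.fderiv_right (m := ∞) (by simp)
  have h := norm_iteratedFDeriv_clm_apply_const (c := v) (x := (z : ℂ)) (n := n)
    hd.contDiffAt (by exact_mod_cast le_top)
  rw [norm_iteratedFDeriv_fderiv] at h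
  exact h.trans (mul_le_mul_of_nonneg_left (le_ciSup (f.bddAbove_range K (n + 1)) z)
    (norm_nonneg v))

/-- The derivative of a smooth function in the real direction `v`, `f ↦ (z ↦ Df(z)v)`, as a
continuous linear operator on `C^∞(ℂ)`. -/
def lineDeriv (v : ℂ) : SmoothFun →L[ℂ] SmoothFun where
  toLinearMap := lineDerivₗ v
  cont := by
    refine WithSeminorms.continuous_of_isBounded withSeminorms withSeminorms _ fun i =>
      ⟨{(i.1, i.2 + 1)}, ‖v‖₊, fun f => ?_⟩
    rw [Finset.sup_singleton]
    exact supSeminorm_lineDerivₗ_le v i.1 i.2 f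

/-- An entire function, regarded as a smooth function. -/
def ofEntire (f : ℂ → ℂ) (hf : Differentiable ℂ f) : SmoothFun :=
  ⟨f, hf.contDiff.restrict_scalars ℝ⟩

/-- The complex conjugate of a smooth function. -/
def conj (f : SmoothFun) : SmoothFun :=
  ⟨fun z => (starRingEnd ℂ) (f z), Complex.conjCLE.contDiff.comp f.contDiff⟩

/-- The pointwise product of two smooth functions. -/
def mul (f g : SmoothFun) : SmoothFun := ⟨fun z => f z * g z, f.contDiff.mul g.contDiff⟩

end SmoothFun

/-- Compactly supported distributions on `ℂ`: the continuous linear functionals on `C^∞(ℂ)`. -/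
abbrev CompactDistribution : Type := SmoothFun →L[ℂ] ℂ

namespace CompactDistribution

/-- `u` is weakly multiplicative: `⟨u, f ḡ⟩ = ⟨u, f⟩ ⟨u, ḡ⟩` for all entire functions `f, g`. -/
def WeaklyMultiplicative (u : CompactDistribution) : Prop :=
  ∀ (f g : ℂ → ℂ) (hf : Differentiable ℂ f) (hg : Differentiable ℂ g),
    u ((SmoothFun.ofEntire f hf).mul (SmoothFun.ofEntire g hg).conj) =
      u (SmoothFun.ofEntire f hf) * u (SmoothFun.ofEntire g hg).conj

/-- Evaluation of smooth functions at a point, as a linear functional. -/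
def diracₗ (a : ℂ) : SmoothFun →ₗ[ℂ] ℂ where
  toFun φ := φ a
  map_add' _ _ := rfl
  map_smul' _ _ := rfl

/-- The Dirac distribution `⟨δ_a, φ⟩ = φ(a)`. -/
def dirac (a : ℂ) : CompactDistribution where
  toLinearMap := diracₗ a
  cont := by
    refine WithSeminorms.continuous_normedSpace_rng ℂ SmoothFun.withSeminorms (diracₗ a)
      ⟨{(⟨{a}, isCompact_singleton⟩, 0)}, 1, fun φ => ?_⟩
    rw [Finset.sup_singleton, one_smul]
    have h := le_ciSup (φ.bddAbove_range ⟨{a}, isCompact_singleton⟩ 0) ⟨a, rfl⟩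
    rw [norm_iteratedFDeriv_zero] at h
    exact h

/-- The distributional derivative in the real direction `v`: `⟨∂_v u, φ⟩ = -⟨u, ∂_v φ⟩`. -/
def lineDeriv (v : ℂ) : CompactDistribution →ₗ[ℂ] CompactDistribution where
  toFun u := -(u.comp (SmoothFun.lineDeriv v))
  map_add' u w := by
    ext φ
    simp [add_comm]
  map_smul' c u := by
    ext φ
    simp

/-- The Cauchy–Riemann operator `∂ = (1/2)(∂_x - i ∂_y)` on distributions. -/
def del : Module.End ℂ CompactDistribution :=
  (1 / 2 : ℂ) • (lineDeriv 1 - Complex.I • lineDeriv Complex.I)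

/-- The Cauchy–Riemann operator `∂̄ = (1/2)(∂_x + i ∂_y)` on distributions. -/
def delbar : Module.End ℂ CompactDistribution :=
  (1 / 2 : ℂ) • (lineDeriv 1 + Complex.I • lineDeriv Complex.I)

/-- The distribution `p(∂) q(∂̄) δ_a`, for complex polynomials `p, q` and a point `a`. -/
def polyDirac (p q : ℂ[X]) (a : ℂ) : CompactDistribution :=
  (Polynomial.aeval del p) ((Polynomial.aeval delbar q) (dirac a))

end CompactDistribution

end

/-! Everything is read off from the Fourier–Laplace transform of `u`, its pairing with exp(αz +
βz̄). Put A(α) = ⟨u, exp(αz)⟩ and B(β) = ⟨u, exp(βz̄)⟩; weak multiplicativity makes the transform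
equal to A(α)B(β). Both factors are entire of exponential growth. On β = -ᾱ the exponent αz -
conj(αz) is purely imaginary, so there the transform grows only polynomially. Hence the entire
function A·H, with H(α) = conj B(-ᾱ), is a polynomial, and it is non-zero because u ≠ 0 forces A(0)
= B(0) = 1.

Dividing out its roots leaves zero-free functions of exponential growth, which are pure
exponentials. So A = p·exp(aα) and H = q·exp(-aα) with the same a
(`exists_polynomial_mul_exp_of_mul_eq`); this common a is the single point of the support. The
right-hand sides are the transform of a distribution p(∂)q(∂̄)δ_a (`polyDirac_apply_expFun`), and
exponentials determine a distribution by Fourier inversion (`eq_zero_of_apply_expFun`).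

Conversely, on f·ḡ the operator ∂ acts on f alone and ∂̄ on ḡ alone, so the pairing with
p(∂)q(∂̄)δ_a splits as a product (`polyDirac_apply_mulConj`). -/

/-! ### Entire functions of polynomial and exponential growth -/

/-- An entire function of polynomial growth is a polynomial. -/
theorem exists_polynomial_of_norm_le {F : ℂ → ℂ} (hF : Differentiable ℂ F) {C : ℝ} {N : ℕ}
    (h : ∀ z, ‖F z‖ ≤ C * (1 + ‖z‖) ^ N) :
    ∃ P : ℂ[X], P.natDegree ≤ N ∧ ∀ z, F z = P.eval z := by
  have hC : 0 ≤ C := by simpa using (norm_nonneg _).trans (h 0)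
  have hz : ∀ n, N < n → iteratedDeriv n F 0 = 0 := by
    intro n hn
    -- Cauchy's estimate on the circle of radius R ≥ 1, where 1 + R ≤ 2R; since n > N, a factor 1/R
    -- survives.
    have hb : ∀ R : ℝ, 1 ≤ R → ‖iteratedDeriv n F 0‖ ≤ n.factorial * (C * 2 ^ N) / R := by
      intro R hR
      have hR0 : 0 < R := by linarith
      have h1 := Complex.norm_iteratedDeriv_le_of_forall_mem_sphere_norm_le (c := 0) n hR0
        hF.diffContOnCl (C := C * (2 * R) ^ N) (fun z hz => by
          have hz : ‖z‖ = R := by simpa using hz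
          refine (h z).trans ?_
          gcongr
          linarith)
      refine h1.trans ?_
      rw [div_le_div_iff₀ (by positivity) hR0, mul_pow]
      have : R ^ N * R ≤ R ^ n := by
        rw [← pow_succ]; exact pow_le_pow_right₀ hR hn
      calc _ = (n.factorial * (C * 2 ^ N)) * (R ^ N * R) := by ring
        _ ≤ _ := by gcongr
    rw [← norm_eq_zero]
    refine le_antisymm ?_ (norm_nonneg _)
    refine ge_of_tendsto ((tendsto_const_nhds (x := n.factorial * (C * 2 ^ N))).div_atTop
      Filter.tendsto_id) ?_
    filter_upwards [Filter.eventually_ge_atTop 1] with R hR using hb R hR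
  refine ⟨∑ n ∈ Finset.range (N + 1), Polynomial.C ((n.factorial : ℂ)⁻¹ * iteratedDeriv n F 0)
    * Polynomial.X ^ n, ?_, fun z => ?_⟩
  · refine Polynomial.natDegree_sum_le_of_forall_le _ _ fun i hi => ?_
    exact (Polynomial.natDegree_C_mul_X_pow_le _ _).trans
      (by have := Finset.mem_range.1 hi; omega)
  · rw [← Complex.taylorSeries_eq_of_entire' 0 z hF, tsum_eq_sum (s := Finset.range (N + 1))]
    · simp [Polynomial.eval_finsetSum]
    · intro n hn
      rw [hz n (by simpa using hn)]
      simp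

/-- A zero-free entire function is the exponential of an entire function. -/
theorem exists_exp_eq_of_ne_zero {F : ℂ → ℂ} (hF : Differentiable ℂ F) (h0 : ∀ z, F z ≠ 0) :
    ∃ g : ℂ → ℂ, Differentiable ℂ g ∧ ∀ z, F z = Complex.exp (g z) := by
  have hd : Differentiable ℂ fun z => deriv F z / F z := fun z =>
    (hF.deriv z).div (hF z) (h0 z)
  obtain ⟨g, hg0, hg⟩ := hd.isExactOn_univ.with_val_at 0 (Complex.log (F 0))
  have hgd : ∀ z, HasDerivAt g (deriv F z / F z) z := fun z => hg z trivial
  refine ⟨g, fun z => (hgd z).differentiableAt, fun z => ?_⟩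
  have hq : ∀ z, HasDerivAt (fun z => F z * Complex.exp (-g z)) 0 z := by
    intro z
    refine ((hF z).hasDerivAt.mul (hgd z).neg.cexp).congr_deriv ?_
    have hz := h0 z
    field_simp
    ring
  have hc := is_const_of_deriv_eq_zero (fun z => (hq z).differentiableAt) (fun z => (hq z).deriv) z 0
  simp only [hg0, Complex.exp_neg, Complex.exp_log (h0 0)] at hc
  rw [mul_inv_cancel₀ (h0 0)] at hc
  exact (mul_inv_eq_one₀ (Complex.exp_ne_zero _)).1 hc

/-- `F` has at most exponential growth. -/
def HasExpGrowth (F : ℂ → ℂ) : Prop :=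
  ∃ A B : ℝ, 0 ≤ A ∧ 0 ≤ B ∧ ∀ z, ‖F z‖ ≤ A * Real.exp (B * ‖z‖)

/-- A logarithm of F has real part bounded above by a linear function of ‖z‖. Borel–Carathéodory
turns this into a linear bound on its modulus, so the logarithm is affine. -/
theorem HasExpGrowth.exists_eq_mul_exp {F : ℂ → ℂ} (hF : Differentiable ℂ F)
    (h0 : ∀ z, F z ≠ 0) (hg : HasExpGrowth F) :
    ∃ k a : ℂ, k ≠ 0 ∧ ∀ z, F z = k * Complex.exp (a * z) := by
  obtain ⟨g, hgd, hFg⟩ := exists_exp_eq_of_ne_zero hF h0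
  obtain ⟨A, B, hA, hB, hAB⟩ := hg
  have hre : ∀ z, (g z).re ≤ A + B * ‖z‖ := by
    intro z
    have h1 := hAB z
    rw [hFg, Complex.norm_exp] at h1
    have h2 : Real.exp (g z).re ≤ Real.exp (A + B * ‖z‖) := by
      rw [Real.exp_add]
      refine h1.trans ?_
      gcongr
      linarith [Real.add_one_le_exp A]
    exact Real.exp_le_exp.1 h2
  have hgrow : ∀ z, ‖g z‖ ≤ (2 * (A + 1 + 2 * B) + 3 * ‖g 0‖) * (1 + ‖z‖) ^ 1 := by
    intro z
    -- This radius gives ‖z‖/(R - ‖z‖) ≤ 1 and (R + ‖z‖)/(R - ‖z‖) ≤ 3.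
    set R : ℝ := 2 * (‖z‖ + 1) with hR
    have hn := norm_nonneg z
    have hRz : 0 < R - ‖z‖ := by linarith
    have h1 := Complex.borelCaratheodory (M := A + 1 + B * R) (R := R) (z := z) (by positivity)
      hgd.differentiableOn (fun w hw => by
        have hw' : ‖w‖ < R := by simpa using hw
        have h3 : B * ‖w‖ ≤ B * R := by gcongr
        have := hre w
        simp only [Set.mem_ofPred_eq]
        linarith) (by linarith) (by simp; linarith)
    refine h1.trans ?_
    have h2 : 2 * (A + 1 + B * R) * ‖z‖ / (R - ‖z‖) ≤ 2 * (A + 1 + B * R) := by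
      rw [div_le_iff₀ hRz]
      gcongr
      linarith
    have h3 : ‖g 0‖ * (R + ‖z‖) / (R - ‖z‖) ≤ 3 * ‖g 0‖ := by
      rw [div_le_iff₀ hRz]
      have := norm_nonneg (g 0)
      nlinarith
    have h4 : 0 ≤ A * ‖z‖ := by positivity
    have h5 : 0 ≤ ‖g 0‖ * ‖z‖ := by positivity
    rw [hR] at h2
    rw [hR] at h3
    nlinarith
  obtain ⟨P, hP, hgP⟩ := exists_polynomial_of_norm_le hgd hgrow
  refine ⟨Complex.exp (P.coeff 0), P.coeff 1, Complex.exp_ne_zero _, fun z => ?_⟩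
  rw [hFg, hgP, Polynomial.eq_X_add_C_of_natDegree_le_one hP, ← Complex.exp_add]
  simp [add_comm]

/-- Outside the closed unit disc about c, division by z - c does not increase the modulus; on the
disc, compactness gives a bound. -/
theorem HasExpGrowth.dslope {F : ℂ → ℂ} (hF : Differentiable ℂ F) (hg : HasExpGrowth F) {c : ℂ}
    (hc : F c = 0) : HasExpGrowth (dslope F c) := by
  obtain ⟨A, B, hA, hB, hAB⟩ := hg
  have hd : Differentiable ℂ (_root_.dslope F c) := by
    rw [← differentiableOn_univ, Complex.differentiableOn_dslope Filter.univ_mem]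
    exact hF.differentiableOn
  obtain ⟨M, hM⟩ := (isCompact_closedBall c 1).exists_bound_of_continuousOn hd.continuous.continuousOn
  have hM0 : 0 ≤ M := (norm_nonneg _).trans (hM c (by simp))
  refine ⟨A + M, B, by positivity, hB, fun z => ?_⟩
  have he : 1 ≤ Real.exp (B * ‖z‖) := Real.one_le_exp (by positivity)
  by_cases hz : z ∈ Metric.closedBall c 1
  · refine (hM z hz).trans ?_
    nlinarith
  · have h1 : 1 < ‖z - c‖ := by simpa [dist_eq_norm] using hz
    have hzc : z ≠ c := by rintro rfl; simp at hz
    rw [dslope_of_ne _ hzc, slope_def_field, hc, sub_zero, norm_div]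
    refine (div_le_self (norm_nonneg _) h1.le).trans ((hAB z).trans ?_)
    gcongr
    linarith

/-- Two entire functions of exponential growth whose product is a non-zero polynomial are, up to
opposite exponential factors, polynomials. -/
theorem exists_polynomial_mul_exp_of_mul_eq (P : ℂ[X]) (hP : P ≠ 0) (F H : ℂ → ℂ)
    (hF : Differentiable ℂ F) (hH : Differentiable ℂ H) (hFg : HasExpGrowth F)
    (hHg : HasExpGrowth H) (hFH : ∀ z, F z * H z = P.eval z) :
    ∃ (p q : ℂ[X]) (a : ℂ), (∀ z, F z = p.eval z * Complex.exp (a * z)) ∧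
      ∀ z, H z = q.eval z * Complex.exp (-(a * z)) := by
  induction hn : P.natDegree generalizing P F H with
  | zero =>
    obtain ⟨k, rfl⟩ : ∃ k, P = Polynomial.C k := ⟨_, Polynomial.eq_C_of_natDegree_eq_zero hn⟩
    have hk : k ≠ 0 := by simpa using hP
    have hF0 : ∀ z, F z ≠ 0 := fun z hz => hk (by simpa [hz] using (hFH z).symm)
    obtain ⟨c, a, hc, hca⟩ := hFg.exists_eq_mul_exp hF hF0
    refine ⟨Polynomial.C c, Polynomial.C (k / c), a, fun z => by simp [hca], fun z => ?_⟩
    have h1 := hFH z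
    have he := Complex.exp_ne_zero (a * z)
    rw [hca, Polynomial.eval_C] at h1
    rw [Complex.exp_neg, Polynomial.eval_C, ← h1]
    field_simp
  | succ n ih =>
    obtain ⟨c, hc⟩ := Complex.exists_root (f := P) (by
      rw [Polynomial.degree_eq_natDegree hP, hn]; exact_mod_cast Nat.succ_pos n)
    obtain ⟨Q, rfl⟩ := Polynomial.dvd_iff_isRoot.2 hc
    have hQ : Q ≠ 0 := right_ne_zero_of_mul hP
    have hQn : Q.natDegree = n := by
      rw [Polynomial.natDegree_mul (Polynomial.X_sub_C_ne_zero c) hQ,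
        Polynomial.natDegree_X_sub_C] at hn
      omega
    -- Stated for arbitrary F and H because the root may belong to either factor; exchanging them
    -- replaces a by -a.
    have key : ∀ F H : ℂ → ℂ, Differentiable ℂ F → Differentiable ℂ H → HasExpGrowth F →
        HasExpGrowth H → (∀ z, F z * H z = ((Polynomial.X - Polynomial.C c) * Q).eval z) →
        F c = 0 → ∃ (p q : ℂ[X]) (a : ℂ), (∀ z, F z = p.eval z * Complex.exp (a * z)) ∧
          ∀ z, H z = q.eval z * Complex.exp (-(a * z)) := by
      intro F H hF hH hFg hHg hFH hFc
      have hd : Differentiable ℂ (dslope F c) := by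
        rw [← differentiableOn_univ, Complex.differentiableOn_dslope Filter.univ_mem]
        exact hF.differentiableOn
      have hs : ∀ z, F z = (z - c) * dslope F c z := by
        intro z
        have := sub_smul_dslope F c z
        rw [hFc, sub_zero, smul_eq_mul] at this
        exact this.symm
      -- The factor z - c cancels away from c, and continuity supplies the value at c.
      have hmul : ∀ z, dslope F c z * H z = Q.eval z := by
        have : (fun z => dslope F c z * H z) = fun z => Q.eval z := by
          refine Continuous.ext_on (dense_compl_singleton c) (hd.continuous.mul hH.continuous)
            Q.continuous fun z hz => ?_
          have h1 := hFH z
          rw [hs, Polynomial.eval_mul] at h1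
          simp only [Polynomial.eval_sub, Polynomial.eval_X, Polynomial.eval_C, mul_assoc] at h1
          exact mul_left_cancel₀ (sub_ne_zero.2 hz) h1
        exact fun z => congrFun this z
      obtain ⟨p, q, a, hp, hq⟩ := ih Q hQ _ H hd hH (hFg.dslope hF hFc) hHg hmul hQn
      refine ⟨(Polynomial.X - Polynomial.C c) * p, q, a, fun z => ?_, hq⟩
      rw [hs, hp]
      simp [mul_assoc]
    have h0 : F c * H c = 0 := by rw [hFH]; simp
    rcases mul_eq_zero.1 h0 with h | h
    · exact key F H hF hH hFg hHg hFH h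
    · obtain ⟨p, q, a, hp, hq⟩ := key H F hH hF hHg hFg (fun z => by rw [mul_comm, hFH]) h
      exact ⟨q, p, -a, fun z => by simp [hq], fun z => by simp [hp]⟩

/-! ### Growth and holomorphy of the Fourier–Laplace transform -/

noncomputable section

namespace SmoothFun

/-- The smooth function `z ↦ exp (ℓ z)`, for a real-linear form `ℓ`. -/
def expFun (ℓ : ℂ →L[ℝ] ℂ) : SmoothFun :=
  ⟨fun z => Complex.exp (ℓ z), Complex.contDiff_exp.comp ℓ.contDiff⟩

theorem expFun_apply (ℓ : ℂ →L[ℝ] ℂ) (z : ℂ) : expFun ℓ z = Complex.exp (ℓ z) := rfl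

/-- The multilinear map `m ↦ ∏ i, ℓ (m i)`. -/
def powMultilinear (n : ℕ) (ℓ : ℂ →L[ℝ] ℂ) : ContinuousMultilinearMap ℝ (fun _ : Fin n => ℂ) ℂ :=
  (ContinuousMultilinearMap.mkPiAlgebra ℝ (Fin n) ℂ).compContinuousLinearMap fun _ => ℓ

theorem powMultilinear_apply (n : ℕ) (ℓ : ℂ →L[ℝ] ℂ) (m : Fin n → ℂ) :
    powMultilinear n ℓ m = ∏ i, ℓ (m i) := by
  simp [powMultilinear]

theorem continuous_powMultilinear (n : ℕ) : Continuous (powMultilinear n) :=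
  (ContinuousMultilinearMap.compContinuousLinearMapContinuousMultilinear ℝ (fun _ : Fin n => ℂ)
    (fun _ : Fin n => ℂ) ℂ).cont.clm_apply continuous_const |>.comp
      (continuous_pi fun _ => continuous_id)

theorem norm_powMultilinear_le (n : ℕ) (ℓ : ℂ →L[ℝ] ℂ) : ‖powMultilinear n ℓ‖ ≤ ‖ℓ‖ ^ n := by
  refine ContinuousMultilinearMap.opNorm_le_bound (by positivity) fun m => ?_
  rw [powMultilinear_apply, norm_prod]
  calc ∏ i, ‖ℓ (m i)‖ ≤ ∏ i, ‖ℓ‖ * ‖m i‖ :=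
        Finset.prod_le_prod (fun _ _ => norm_nonneg _) fun i _ => ℓ.le_opNorm _
    _ = _ := by simp [Finset.prod_mul_distrib]

theorem powMultilinear_smul (n : ℕ) (α : ℂ) (ℓ : ℂ →L[ℝ] ℂ) :
    powMultilinear n (α • ℓ) = α ^ n • powMultilinear n ℓ := by
  ext m
  simp [powMultilinear_apply, Finset.prod_mul_distrib]

theorem iteratedFDeriv_expFun (ℓ : ℂ →L[ℝ] ℂ) (n : ℕ) :
    iteratedFDeriv ℝ n (expFun ℓ) = fun z => Complex.exp (ℓ z) • powMultilinear n ℓ := by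
  induction n with
  | zero =>
    ext z m
    simp [powMultilinear_apply, expFun_apply]
  | succ n ih =>
    ext z m
    have h : HasFDerivAt (fun z => Complex.exp (ℓ z) • powMultilinear n ℓ) _ z :=
      (ℓ.hasFDerivAt (x := z)).cexp.smul_const (powMultilinear n ℓ)
    rw [iteratedFDeriv_succ_apply_left, ih, h.fderiv]
    simp [powMultilinear_apply, Fin.prod_univ_succ, Fin.tail, mul_assoc]

/-- Finite families of continuous multilinear-map-valued functions on compact sets. -/
def JetSpace (s : Finset (TopologicalSpace.Compacts ℂ × ℕ)) : Type :=
  (i : s) → C(i.1.1, ContinuousMultilinearMap ℝ (fun _ : Fin i.1.2 => ℂ) ℂ)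

namespace JetSpace

variable (s : Finset (TopologicalSpace.Compacts ℂ × ℕ))

instance : NormedAddCommGroup (JetSpace s) := inferInstanceAs (NormedAddCommGroup
  ((i : s) → C(i.1.1, ContinuousMultilinearMap ℝ (fun _ : Fin i.1.2 => ℂ) ℂ)))

instance : NormedSpace ℂ (JetSpace s) := inferInstanceAs (NormedSpace ℂ
  ((i : s) → C(i.1.1, ContinuousMultilinearMap ℝ (fun _ : Fin i.1.2 => ℂ) ℂ)))

instance : CompleteSpace (JetSpace s) := inferInstanceAs (CompleteSpace
  ((i : s) → C(i.1.1, ContinuousMultilinearMap ℝ (fun _ : Fin i.1.2 => ℂ) ℂ)))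

variable {s}

theorem norm_le_iff (x : JetSpace s) {C : ℝ} (hC : 0 ≤ C) :
    ‖x‖ ≤ C ↔ ∀ i z, ‖x i z‖ ≤ C :=
  (pi_norm_le_iff_of_nonneg (x := fun i => x i) hC).trans
    (forall_congr' fun _ => ContinuousMap.norm_le _ hC)

theorem norm_apply_le (x : JetSpace s) (i : s) (z : i.1.1) : ‖x i z‖ ≤ ‖x‖ :=
  (norm_le_iff x (norm_nonneg _)).1 le_rfl i z

end JetSpace

/-- The map sending a smooth function to the restrictions of its derivatives to compact sets. -/
def jet (s : Finset (TopologicalSpace.Compacts ℂ × ℕ)) : SmoothFun →ₗ[ℂ] JetSpace s where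
  toFun f i := ⟨fun z => iteratedFDeriv ℝ i.1.2 f z,
    (f.continuous_iteratedFDeriv _).comp continuous_subtype_val⟩
  map_add' f g := by
    refine funext fun i => ContinuousMap.ext fun z => ?_
    have hn : ((i.1.2 : ℕ) : WithTop ℕ∞) ≤ ∞ := by exact_mod_cast le_top
    exact iteratedFDeriv_add_apply (f.contDiff.of_le hn).contDiffAt
      (g.contDiff.of_le hn).contDiffAt
  map_smul' c f := by
    refine funext fun i => ContinuousMap.ext fun z => ?_
    have hn : ((i.1.2 : ℕ) : WithTop ℕ∞) ≤ ∞ := by exact_mod_cast le_top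
    exact iteratedFDeriv_const_smul_apply (f.contDiff.of_le hn).contDiffAt

theorem jet_apply (s : Finset (TopologicalSpace.Compacts ℂ × ℕ)) (f : SmoothFun) (i : s)
    (z : i.1.1) : jet s f i z = iteratedFDeriv ℝ i.1.2 f z := rfl

theorem finset_sup_seminormFamily_le (s : Finset (TopologicalSpace.Compacts ℂ × ℕ))
    (f : SmoothFun) : s.sup seminormFamily f ≤ ‖jet s f‖ := by
  refine Seminorm.finset_sup_apply_le (norm_nonneg _) fun i hi => ?_
  change supSeminorm i f ≤ _
  rw [supSeminorm_apply]
  refine Real.iSup_le (fun z => ?_) (norm_nonneg _)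
  exact (jet s f).norm_apply_le ⟨i, hi⟩ z

theorem continuous_jet_expFun (s : Finset (TopologicalSpace.Compacts ℂ × ℕ)) :
    Continuous fun ℓ => jet s (expFun ℓ) := by
  refine continuous_pi (f := fun ℓ i => jet s (expFun ℓ) i) fun i => ContinuousMap.continuous_of_continuous_uncurry _ ?_
  have : (Function.uncurry fun (ℓ : ℂ →L[ℝ] ℂ) (z : i.1.1) => jet s (expFun ℓ) i z) =
      fun p => Complex.exp (p.1 p.2) • powMultilinear i.1.2 p.1 := by
    ext1 p
    simp only [Function.uncurry, jet_apply, iteratedFDeriv_expFun]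
  rw [this]
  have h1 := (continuous_powMultilinear i.1.2).comp
    (continuous_fst : Continuous fun p : (ℂ →L[ℝ] ℂ) × i.1.1 => p.1)
  have h2 : Continuous fun p : (ℂ →L[ℝ] ℂ) × i.1.1 => Complex.exp (p.1 p.2) := by fun_prop
  exact h2.smul h1

/-- The easy half of Paley–Wiener: each derivative of exp ∘ ℓ is itself times a power of ℓ. Keeping
the bound M on Re ℓ separate from ‖ℓ‖ yields exponential growth in general and polynomial growth
when Re ℓ = 0. -/
theorem exists_norm_jet_expFun_le (s : Finset (TopologicalSpace.Compacts ℂ × ℕ)) :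
    ∃ (N : ℕ) (R : ℝ), 0 ≤ R ∧ ∀ (ℓ : ℂ →L[ℝ] ℂ) (M : ℝ), (∀ z, ‖z‖ ≤ R → (ℓ z).re ≤ M) →
      ‖jet s (expFun ℓ)‖ ≤ Real.exp M * (1 + ‖ℓ‖) ^ N := by
  have hK : IsCompact (⋃ i ∈ s, (i.1 : Set ℂ)) := s.isCompact_biUnion fun i _ => i.1.isCompact
  obtain ⟨R, hR0, hR⟩ := hK.isBounded.exists_pos_norm_le
  refine ⟨s.sup Prod.snd, R, hR0.le, fun ℓ M hM => ?_⟩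
  refine (JetSpace.norm_le_iff _ (by positivity)).2 fun i z => ?_
  rw [jet_apply, iteratedFDeriv_expFun, norm_smul, Complex.norm_exp]
  have hz : ‖(z : ℂ)‖ ≤ R := hR _ (Set.mem_biUnion i.2 z.2)
  have hi : i.1.2 ≤ s.sup Prod.snd := Finset.le_sup (f := Prod.snd) i.2
  have h1 : ‖powMultilinear i.1.2 ℓ‖ ≤ (1 + ‖ℓ‖) ^ s.sup Prod.snd := by
    refine (norm_powMultilinear_le _ _).trans ?_
    refine (pow_le_pow_left₀ (norm_nonneg _) (by linarith) _).trans
      (pow_le_pow_right₀ (by linarith [norm_nonneg ℓ]) hi)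
  have := hM z hz
  gcongr

/-- Over a compact K, the component of order n is αⁿ times a continuous linear image of exp(α·ι) in
the Banach algebra C(K, ℂ), where ι is ℓ restricted to K. -/
theorem differentiable_jet_expFun_smul (s : Finset (TopologicalSpace.Compacts ℂ × ℕ))
    (ℓ : ℂ →L[ℝ] ℂ) : Differentiable ℂ fun α : ℂ => jet s (expFun (α • ℓ)) := by
  refine (differentiable_pi (Φ := fun (α : ℂ) (i : s) => jet s (expFun (α • ℓ)) i)).2 fun i => ?_
  let ι : C(i.1.1, ℂ) := ⟨fun z => ℓ z, by fun_prop⟩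
  let Ψ : C(i.1.1, ℂ) →L[ℂ] C(i.1.1, ContinuousMultilinearMap ℝ (fun _ : Fin i.1.2 => ℂ) ℂ) :=
    (ContinuousLinearMap.toSpanSingleton ℂ (powMultilinear i.1.2 ℓ)).compLeftContinuous ℂ i.1.1
  have h : (fun α : ℂ => jet s (expFun (α • ℓ)) i) =
      fun α => α ^ i.1.2 • Ψ (NormedSpace.exp (α • ι)) := by
    ext1 α
    ext1 z
    have he : (NormedSpace.exp (α • ι)) z = Complex.exp (α * ℓ z) := by
      have := NormedSpace.map_exp (ContinuousMap.evalAlgHom ℂ ℂ z) (continuous_eval_const z)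
        (α • ι)
      rw [Complex.exp_eq_exp_ℂ]
      exact this
    rw [jet_apply, iteratedFDeriv_expFun, powMultilinear_smul]
    simp [Ψ, he, smul_smul, mul_comm]
  rw [h]
  have h1 : Differentiable ℂ fun α : ℂ => NormedSpace.exp (α • ι) := fun α =>
    (hasDerivAt_exp_smul_const ι α).differentiableAt
  have h2 := Differentiable.comp (E := ℂ) (F := C(i.1.1, ℂ))
    (G := C(i.1.1, ContinuousMultilinearMap ℝ (fun _ : Fin i.1.2 => ℂ) ℂ)) Ψ.differentiable h1
  exact (differentiable_id.pow _).smul h2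

end SmoothFun

namespace CompactDistribution
open SmoothFun

/-- A compactly supported distribution factors through finitely many derivatives on compact
sets. -/
theorem exists_eq_comp_jet (u : CompactDistribution) :
    ∃ (s : Finset (TopologicalSpace.Compacts ℂ × ℕ)) (L : StrongDual ℂ (JetSpace s)),
      ∀ f, u f = L (jet s f) := by
  obtain ⟨s, C, -, hC⟩ := Seminorm.bound_of_continuous withSeminorms
    ((normSeminorm ℂ ℂ).comp u.toLinearMap) (continuous_norm.comp u.continuous)
  have hb : ∀ f, ‖u f‖ ≤ C * ‖jet s f‖ := fun f =>
    (hC f).trans (mul_le_mul_of_nonneg_left (finset_sup_seminormFamily_le s f) C.2)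
  -- The seminorm bound lets `u` descend to a bounded functional on the range of `jet s`, which
  -- Hahn–Banach then extends.
  have hker : LinearMap.ker (jet s) ≤ LinearMap.ker u.toLinearMap := by
    intro f hf
    have := hb f
    rw [LinearMap.mem_ker.1 hf] at this
    simpa using this
  let v : LinearMap.range (jet s) →ₗ[ℂ] ℂ :=
    ((LinearMap.ker (jet s)).liftQ u.toLinearMap hker).comp
      (jet s).quotKerEquivRange.symm.toLinearMap
  have hv : ∀ f, v ⟨jet s f, LinearMap.mem_range_self _ f⟩ = u f := by
    intro f
    have : (jet s).quotKerEquivRange.symm ⟨jet s f, LinearMap.mem_range_self _ f⟩ =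
        (LinearMap.ker (jet s)).mkQ f := by
      rw [LinearEquiv.symm_apply_eq]
      rfl
    simp [v, this]
  let v' : StrongDual ℂ (LinearMap.range (jet s)) := v.mkContinuous C (by
    rintro ⟨_, f, rfl⟩
    rw [hv]
    exact hb f)
  obtain ⟨L, hL, -⟩ := exists_extension_norm_eq _ v'
  exact ⟨s, L, fun f => ((hL ⟨jet s f, LinearMap.mem_range_self _ f⟩).trans (hv f)).symm⟩

theorem exists_norm_apply_expFun_le (u : CompactDistribution) :
    ∃ (C : ℝ) (N : ℕ) (R : ℝ), 0 ≤ C ∧ 0 ≤ R ∧ ∀ (ℓ : ℂ →L[ℝ] ℂ) (M : ℝ),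
      (∀ z, ‖z‖ ≤ R → (ℓ z).re ≤ M) → ‖u (expFun ℓ)‖ ≤ C * (Real.exp M * (1 + ‖ℓ‖) ^ N) := by
  obtain ⟨s, L, hL⟩ := u.exists_eq_comp_jet
  obtain ⟨N, R, hR, h⟩ := exists_norm_jet_expFun_le s
  refine ⟨‖L‖, N, R, norm_nonneg _, hR, fun ℓ M hM => ?_⟩
  rw [hL]
  exact (L.le_opNorm _).trans (by gcongr; exact h ℓ M hM)

theorem differentiable_apply_expFun_smul (u : CompactDistribution) (ℓ : ℂ →L[ℝ] ℂ) :
    Differentiable ℂ fun α : ℂ => u (expFun (α • ℓ)) := by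
  obtain ⟨s, L, hL⟩ := u.exists_eq_comp_jet
  simp only [hL]
  exact L.differentiable.comp (differentiable_jet_expFun_smul s ℓ)

theorem hasExpGrowth_apply_expFun_smul (u : CompactDistribution) (ℓ : ℂ →L[ℝ] ℂ) :
    HasExpGrowth fun α : ℂ => u (expFun (α • ℓ)) := by
  obtain ⟨C, N, R, hC, hR, h⟩ := u.exists_norm_apply_expFun_le
  -- The first summand bounds Re(αℓ) on the ball of radius R; the second absorbs the polynomial
  -- factor through 1 + x ≤ exp x.
  refine ⟨C, ‖ℓ‖ * R + N * ‖ℓ‖, hC, by positivity, fun α => ?_⟩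
  refine (h (α • ℓ) (‖ℓ‖ * R * ‖α‖) fun z hz => ?_).trans ?_
  · refine (Complex.re_le_norm _).trans (((α • ℓ).le_opNorm z).trans ?_)
    rw [norm_smul]
    calc ‖α‖ * ‖ℓ‖ * ‖z‖ ≤ ‖α‖ * ‖ℓ‖ * R := by gcongr
      _ = _ := by ring
  · rw [norm_smul, add_mul, Real.exp_add]
    have : (1 + ‖α‖ * ‖ℓ‖) ^ N ≤ Real.exp (N * ‖ℓ‖ * ‖α‖) := by
      calc (1 + ‖α‖ * ‖ℓ‖) ^ N ≤ Real.exp (‖α‖ * ‖ℓ‖) ^ N := by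
            gcongr
            linarith [Real.add_one_le_exp (‖α‖ * ‖ℓ‖)]
        _ = _ := by rw [← Real.exp_nat_mul]; ring_nf
    gcongr

end CompactDistribution
end

/-! ### Exponentials determine a distribution: Fourier inversion -/

noncomputable section

namespace SmoothFun
open scoped FourierTransform SchwartzMap

/-- Evaluation of a jet at a point. -/
def JetSpace.evalCLM {s : Finset (TopologicalSpace.Compacts ℂ × ℕ)} (i : s) (z : i.1.1) :
    JetSpace s →L[ℂ] ContinuousMultilinearMap ℝ (fun _ : Fin i.1.2 => ℂ) ℂ :=
  LinearMap.mkContinuous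
    { toFun := fun x => x i z
      map_add' := fun _ _ => rfl
      map_smul' := fun _ _ => rfl } 1 fun x => by
    rw [one_mul]; exact x.norm_apply_le i z

theorem jet_congr (s : Finset (TopologicalSpace.Compacts ℂ × ℕ)) {f g : SmoothFun}
    (h : ∀ i ∈ s, ∀ z ∈ i.1, (f : ℂ → ℂ) =ᶠ[nhds z] g) : jet s f = jet s g := by
  refine funext fun i => ContinuousMap.ext fun z => ?_
  exact ((h i.1 i.2 z z.2).iteratedFDeriv ℝ i.1.2).self_of_nhds

/-- The form `z ↦ -2πi ⟨v, z⟩` on the real Euclidean space `ℂ`. -/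
def fourierForm (v : ℂ) : ℂ →L[ℝ] ℂ :=
  (-(2 * Real.pi * Complex.I)) • Complex.ofRealCLM.comp (innerSL ℝ v)

theorem fourierForm_apply (v z : ℂ) :
    fourierForm v z = -(2 * Real.pi * Complex.I) * ((inner ℝ v z : ℝ) : ℂ) := rfl

theorem fourierForm_re (v z : ℂ) : (fourierForm v z).re = 0 := by
  simp [fourierForm_apply]

theorem continuous_fourierForm : Continuous fourierForm := by
  unfold fourierForm
  fun_prop

theorem norm_fourierForm_le (v : ℂ) : ‖fourierForm v‖ ≤ 2 * Real.pi * ‖v‖ := by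
  refine ContinuousLinearMap.opNorm_le_bound _ (by positivity) fun z => ?_
  rw [fourierForm_apply, norm_mul, Complex.norm_real]
  have : ‖(-(2 * Real.pi * Complex.I) : ℂ)‖ = 2 * Real.pi := by
    simp [abs_of_pos Real.pi_pos]
  rw [this, mul_assoc (2 * Real.pi)]
  gcongr
  exact norm_inner_le_norm (𝕜 := ℝ) v z

theorem iteratedFDeriv_fourier_eq (g : 𝓢(ℂ, ℂ)) (n : ℕ) (z : ℂ) :
    iteratedFDeriv ℝ n (𝓕 (g : ℂ → ℂ)) z =
      ∫ v, g v • iteratedFDeriv ℝ n (expFun (fourierForm v)) z := by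
  rw [Real.iteratedFDeriv_fourier (N := ⊤) (fun k _ => g.integrable_pow_mul _ k)
    g.continuous.aestronglyMeasurable le_top, Real.fourier_eq']
  congr 1
  ext v m
  rw [iteratedFDeriv_expFun]
  simp only [smul_apply, powMultilinear_apply, fourierForm_apply,
    VectorFourier.fourierPowSMulRight_apply, Finset.prod_mul_distrib, smul_eq_mul,
    Finset.prod_const, Finset.card_univ, Fintype.card_fin]
  have : (((-2 * Real.pi * inner ℝ v z : ℝ) : ℂ) * Complex.I) =
      -(2 * Real.pi * Complex.I) * ((inner ℝ v z : ℝ) : ℂ) := by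
    push_cast; ring
  have hi : ∀ i, innerSL ℝ v (m i) = inner ℝ v (m i) := fun _ => rfl
  simp only [this, Complex.real_smul, hi]
  push_cast
  ring

/-- Fourier exponents are purely imaginary, so the jets grow polynomially in v and the Schwartz
decay of g dominates. -/
theorem integrable_smul_jet_expFun (s : Finset (TopologicalSpace.Compacts ℂ × ℕ))
    (g : 𝓢(ℂ, ℂ)) :
    MeasureTheory.Integrable fun v => g v • jet s (expFun (fourierForm v)) := by
  obtain ⟨N, R, -, h⟩ := exists_norm_jet_expFun_le s
  have h1 : MeasureTheory.Integrable fun v : ℂ =>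
      (2 ^ (N - 1) : ℝ) * (‖v‖ ^ 0 * ‖g v‖ + (2 * Real.pi) ^ N * (‖v‖ ^ N * ‖g v‖)) :=
    ((g.integrable_pow_mul _ 0).add ((g.integrable_pow_mul _ N).const_mul _)).const_mul _
  refine h1.mono' ?_ (Filter.Eventually.of_forall fun v => ?_)
  · exact (g.continuous.smul ((continuous_jet_expFun s).comp
      continuous_fourierForm)).aestronglyMeasurable
  · have h2 : ‖jet s (expFun (fourierForm v))‖ ≤ (1 + ‖fourierForm v‖) ^ N := by
      simpa using h (fourierForm v) 0 fun z _ => (fourierForm_re v z).le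
    have h3 : (1 + ‖fourierForm v‖) ^ N ≤ 2 ^ (N - 1) * (1 ^ N + (2 * Real.pi * ‖v‖) ^ N) :=
      (pow_le_pow_left₀ (by positivity) (by linarith [norm_fourierForm_le v]) N).trans
        (add_pow_le zero_le_one (by positivity) N)
    rw [norm_smul]
    calc ‖g v‖ * ‖jet s (expFun (fourierForm v))‖
        ≤ ‖g v‖ * (2 ^ (N - 1) * (1 ^ N + (2 * Real.pi * ‖v‖) ^ N)) := by
          gcongr
          exact h2.trans h3
      _ = _ := by rw [mul_pow]; ring

/-- As an identity of Bochner integrals in the Banach space of jets, this lets a continuous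
functional on jets pass under the integral sign. -/
theorem jet_eq_integral (s : Finset (TopologicalSpace.Compacts ℂ × ℕ)) (g : 𝓢(ℂ, ℂ))
    (f : SmoothFun) (hf : (f : ℂ → ℂ) = 𝓕 (g : ℂ → ℂ)) :
    jet s f = ∫ v, g v • jet s (expFun (fourierForm v)) := by
  refine funext fun i => ContinuousMap.ext fun z => ?_
  change _ = JetSpace.evalCLM i z (∫ v, g v • jet s (expFun (fourierForm v)))
  rw [← ContinuousLinearMap.integral_comp_comm _ (integrable_smul_jet_expFun s g), jet_apply, hf,
    iteratedFDeriv_fourier_eq]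
  rfl

end SmoothFun

namespace CompactDistribution
open SmoothFun
open scoped FourierTransform SchwartzMap

/-- A compactly supported distribution that vanishes on all exponentials is zero. -/
theorem eq_zero_of_apply_expFun (u : CompactDistribution) (h : ∀ ℓ, u (expFun ℓ) = 0) : u = 0 := by
  ext f
  obtain ⟨s, L, hL⟩ := u.exists_eq_comp_jet
  have hK : IsCompact (⋃ i ∈ s, (i.1 : Set ℂ)) := s.isCompact_biUnion fun i _ => i.1.isCompact
  obtain ⟨R, hR0, hR⟩ := hK.isBounded.exists_pos_norm_le
  -- χ equals 1 on a neighbourhood of every compact set involved, so the cut-off does not change the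
  -- jet.
  let χ : ContDiffBump (0 : ℂ) := ⟨R + 1, R + 2, by linarith, by linarith⟩
  let φ : SmoothFun := ⟨fun z => (χ z : ℂ) * f z,
    (Complex.ofRealCLM.contDiff.comp χ.contDiff).mul f.contDiff⟩
  have hφc : HasCompactSupport (φ : ℂ → ℂ) :=
    (χ.hasCompactSupport.comp_left (g := fun x : ℝ => (x : ℂ)) Complex.ofReal_zero).mul_right
  have hφf : jet s f = jet s φ := by
    refine jet_congr s fun i hi z hz => ?_
    have hzR : ‖z‖ ≤ R := hR z (Set.mem_biUnion hi hz)
    have := χ.eventuallyEq_one_of_mem_ball (x := z) (by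
      simp only [Metric.mem_ball, dist_zero_right, χ]; linarith)
    filter_upwards [this] with w hw
    change f w = (χ w : ℂ) * f w
    simp [hw]
  let ψ : 𝓢(ℂ, ℂ) := hφc.toSchwartzMap φ.contDiff
  -- By Fourier inversion φ is a superposition of exponentials, on each of which `u` vanishes.
  have hψ : (φ : ℂ → ℂ) = 𝓕 ((𝓕⁻ ψ : 𝓢(ℂ, ℂ)) : ℂ → ℂ) := by
    rw [← SchwartzMap.fourier_coe, FourierTransform.fourier_fourierInv_eq]
    rfl
  rw [hL, hφf, jet_eq_integral s _ φ hψ,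
    ← ContinuousLinearMap.integral_comp_comm _ (integrable_smul_jet_expFun s _)]
  simp [← hL, h]

end CompactDistribution
end

/-! ### Pairing p(∂)q(∂̄)δ_a with products f·ḡ -/

noncomputable section

namespace SmoothFun

/-- The smooth function `f * conj g`, for entire functions `f` and `g`. -/
def mulConj (f g : ℂ → ℂ) (hf : Differentiable ℂ f) (hg : Differentiable ℂ g) : SmoothFun :=
  (ofEntire f hf).mul (ofEntire g hg).conj

theorem mulConj_apply {f g : ℂ → ℂ} (hf : Differentiable ℂ f) (hg : Differentiable ℂ g) (z : ℂ) :
    mulConj f g hf hg z = f z * (starRingEnd ℂ) (g z) := rfl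

theorem lineDeriv_mulConj {f g : ℂ → ℂ} (hf : Differentiable ℂ f) (hg : Differentiable ℂ g)
    (v : ℂ) :
    lineDeriv v (mulConj f g hf hg) = v • mulConj (deriv f) g hf.deriv hg +
      (starRingEnd ℂ) v • mulConj f (deriv g) hf hg.deriv := by
  ext z
  have h1 : HasFDerivAt f _ z := (hf z).hasDerivAt.complexToReal_fderiv
  have h2 : HasFDerivAt (fun z => (starRingEnd ℂ) (g z)) _ z :=
    Complex.conjCLE.hasFDerivAt.comp z (hg z).hasDerivAt.complexToReal_fderiv
  change fderiv ℝ (fun z => f z * (starRingEnd ℂ) (g z)) z v =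
    v * (deriv f z * (starRingEnd ℂ) (g z)) +
      (starRingEnd ℂ) v * (f z * (starRingEnd ℂ) (deriv g z))
  have h3 : HasFDerivAt (fun z => f z * (starRingEnd ℂ) (g z)) _ z := h1.mul h2
  rw [h3.fderiv]
  simp
  ring

theorem differentiable_iteratedDeriv {f : ℂ → ℂ} (hf : Differentiable ℂ f) (n : ℕ) :
    Differentiable ℂ (iteratedDeriv n f) :=
  (hf.contDiff (n := ⊤)).differentiable_iteratedDeriv n (by exact_mod_cast WithTop.coe_lt_top _)

theorem mulConj_congr {f f' g g' : ℂ → ℂ} (hf : Differentiable ℂ f) (hg : Differentiable ℂ g)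
    (hf' : Differentiable ℂ f') (hg' : Differentiable ℂ g') (h : f = f') (h' : g = g') :
    mulConj f g hf hg = mulConj f' g' hf' hg' := by
  subst h h'; rfl

end SmoothFun

namespace CompactDistribution
open SmoothFun

theorem lineDeriv_apply (v : ℂ) (w : CompactDistribution) (φ : SmoothFun) :
    lineDeriv v w φ = -w (SmoothFun.lineDeriv v φ) := rfl

theorem del_apply (w : CompactDistribution) (φ : SmoothFun) :
    del w φ = 1 / 2 * (lineDeriv 1 w φ - Complex.I * lineDeriv Complex.I w φ) := rfl

theorem delbar_apply (w : CompactDistribution) (φ : SmoothFun) :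
    delbar w φ = 1 / 2 * (lineDeriv 1 w φ + Complex.I * lineDeriv Complex.I w φ) := rfl

theorem del_apply_mulConj (w : CompactDistribution) {f g : ℂ → ℂ} (hf : Differentiable ℂ f)
    (hg : Differentiable ℂ g) :
    del w (mulConj f g hf hg) = -w (mulConj (deriv f) g hf.deriv hg) := by
  rw [del_apply, lineDeriv_apply, lineDeriv_apply, lineDeriv_mulConj, lineDeriv_mulConj]
  simp only [map_add, map_smul, smul_eq_mul, map_one, Complex.conj_I]
  linear_combination (1 / 2 * w (mulConj (deriv f) g hf.deriv hg)
    - 1 / 2 * w (mulConj f (deriv g) hf hg.deriv)) * Complex.I_mul_I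

theorem delbar_apply_mulConj (w : CompactDistribution) {f g : ℂ → ℂ} (hf : Differentiable ℂ f)
    (hg : Differentiable ℂ g) :
    delbar w (mulConj f g hf hg) = -w (mulConj f (deriv g) hf hg.deriv) := by
  rw [delbar_apply, lineDeriv_apply, lineDeriv_apply, lineDeriv_mulConj, lineDeriv_mulConj]
  simp only [map_add, map_smul, smul_eq_mul, map_one, Complex.conj_I]
  linear_combination (-1 / 2 * w (mulConj (deriv f) g hf.deriv hg)
    + 1 / 2 * w (mulConj f (deriv g) hf hg.deriv)) * Complex.I_mul_I

/-- If the transpose of `T` shifts the sequence `φ` up to sign, then `p(T)` acts on `φ 0` through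
the coefficients of `p`. -/
theorem aeval_apply_eq_sum (T : Module.End ℂ CompactDistribution) (p : ℂ[X]) (φ : ℕ → SmoothFun)
    (h : ∀ w n, T w (φ n) = -w (φ (n + 1))) (w : CompactDistribution) :
    Polynomial.aeval T p w (φ 0) =
      ∑ n ∈ Finset.range (p.natDegree + 1), p.coeff n * ((-1) ^ n * w (φ n)) := by
  have hp : ∀ n w k, (T ^ n) w (φ k) = (-1) ^ n * w (φ (k + n)) := by
    intro n
    induction n with
    | zero => simp
    | succ n ih =>
      intro w k
      rw [pow_succ, Module.End.mul_apply, ih, h, pow_succ, add_assoc]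
      ring
  have e : ∀ (t : Finset ℕ) (c : ℕ → Module.End ℂ CompactDistribution),
      (∑ n ∈ t, c n) w (φ 0) = ∑ n ∈ t, c n w (φ 0) := by
    intro t c
    rw [LinearMap.sum_apply]
    exact sum_apply _ _ _
  rw [Polynomial.aeval_eq_sum_range, e]
  refine Finset.sum_congr rfl fun n _ => ?_
  change p.coeff n * (T ^ n) w (φ 0) = _
  rw [hp, zero_add]

/-- The value at `a` of the differential operator `p(-d/dz)` applied to `f`. -/
def polyDerivAt (p : ℂ[X]) (f : ℂ → ℂ) (a : ℂ) : ℂ :=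
  ∑ n ∈ Finset.range (p.natDegree + 1), p.coeff n * ((-1) ^ n * iteratedDeriv n f a)

theorem polyDerivAt_one (p : ℂ[X]) (a : ℂ) : polyDerivAt p (fun _ => 1) a = p.eval 0 := by
  rw [polyDerivAt, Finset.sum_eq_single 0]
  · simp [Polynomial.coeff_zero_eq_eval_zero]
  · intro n _ hn
    simp [iteratedDeriv_const, hn]
  · simp

theorem polyDerivAt_exp (p : ℂ[X]) (c a : ℂ) :
    polyDerivAt p (fun z => Complex.exp (c * z)) a = p.eval (-c) * Complex.exp (c * a) := by
  rw [polyDerivAt, Polynomial.eval_eq_sum_range, Finset.sum_mul]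
  refine Finset.sum_congr rfl fun n _ => ?_
  rw [iteratedDeriv_cexp_const_mul, neg_pow]
  ring

theorem aeval_del_apply_mulConj (p : ℂ[X]) (w : CompactDistribution) {f g : ℂ → ℂ}
    (hf : Differentiable ℂ f) (hg : Differentiable ℂ g) :
    Polynomial.aeval del p w (mulConj f g hf hg) =
      ∑ n ∈ Finset.range (p.natDegree + 1), p.coeff n *
        ((-1) ^ n * w (mulConj (iteratedDeriv n f) g (differentiable_iteratedDeriv hf n) hg)) :=
  aeval_apply_eq_sum del p
    (fun n => mulConj (iteratedDeriv n f) g (differentiable_iteratedDeriv hf n) hg)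
    (fun w n => by
      rw [del_apply_mulConj]
      congr 2
      exact mulConj_congr _ _ _ _ iteratedDeriv_succ.symm rfl) w

theorem aeval_delbar_apply_mulConj (q : ℂ[X]) (w : CompactDistribution) {f g : ℂ → ℂ}
    (hf : Differentiable ℂ f) (hg : Differentiable ℂ g) :
    Polynomial.aeval delbar q w (mulConj f g hf hg) =
      ∑ n ∈ Finset.range (q.natDegree + 1), q.coeff n *
        ((-1) ^ n * w (mulConj f (iteratedDeriv n g) hf (differentiable_iteratedDeriv hg n))) :=
  aeval_apply_eq_sum delbar q
    (fun n => mulConj f (iteratedDeriv n g) hf (differentiable_iteratedDeriv hg n))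
    (fun w n => by
      rw [delbar_apply_mulConj]
      congr 2
      exact mulConj_congr _ _ _ _ rfl iteratedDeriv_succ.symm) w

/-- f is holomorphic and ḡ antiholomorphic, so ∂ differentiates only f and ∂̄ only ḡ. The
coefficients of q are conjugated because the second factor is written as the conjugate of an
expression in g. -/
theorem polyDirac_apply_mulConj (p q : ℂ[X]) (a : ℂ) {f g : ℂ → ℂ}
    (hf : Differentiable ℂ f) (hg : Differentiable ℂ g) :
    polyDirac p q a (mulConj f g hf hg) = polyDerivAt p f a *
      (starRingEnd ℂ) (polyDerivAt (q.map (starRingEnd ℂ)) g a) := by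
  have h : ∀ f' : ℂ → ℂ, ∀ hf' : Differentiable ℂ f',
      Polynomial.aeval delbar q (dirac a) (mulConj f' g hf' hg) =
        f' a * (starRingEnd ℂ) (polyDerivAt (q.map (starRingEnd ℂ)) g a) := by
    intro f' hf'
    rw [aeval_delbar_apply_mulConj, polyDerivAt, map_sum, Finset.mul_sum,
      Polynomial.natDegree_map]
    refine Finset.sum_congr rfl fun n _ => ?_
    change q.coeff n * ((-1) ^ n * (f' a * (starRingEnd ℂ) (iteratedDeriv n g a))) = _
    simp
    ring
  rw [polyDirac, aeval_del_apply_mulConj, polyDerivAt, Finset.sum_mul]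
  refine Finset.sum_congr rfl fun n _ => ?_
  rw [h]
  ring

theorem polyDirac_apply_one (p q : ℂ[X]) (hp : p.eval 0 = 1) (hq : q.eval 0 = 1) (a : ℂ) :
    polyDirac p q a (mulConj (fun _ => 1) (fun _ => 1) (differentiable_const 1)
      (differentiable_const 1)) = 1 := by
  have : (q.map (starRingEnd ℂ)).eval 0 = 1 := by
    rw [← map_zero (starRingEnd ℂ), Polynomial.eval_map_apply, hq, map_one]
  rw [polyDirac_apply_mulConj, polyDerivAt_one, polyDerivAt_one, hp, this, map_one, mul_one]

/-- All three pairings split, and the factors coming from the constant 1 are p(0) = 1 and q(0) = 1.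
-/
theorem weaklyMultiplicative_polyDirac (p q : ℂ[X]) (hp : p.eval 0 = 1) (hq : q.eval 0 = 1)
    (a : ℂ) : (polyDirac p q a).WeaklyMultiplicative := by
  intro f g hf hg
  have hq' : (q.map (starRingEnd ℂ)).eval 0 = 1 := by
    rw [← map_zero (starRingEnd ℂ), Polynomial.eval_map_apply, hq, map_one]
  have h1 : ofEntire f hf = mulConj f (fun _ => 1) hf (differentiable_const 1) := by
    ext z
    rw [mulConj_apply, map_one, mul_one]
    rfl
  have h2 : (ofEntire g hg).conj = mulConj (fun _ => 1) g (differentiable_const 1) hg := by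
    ext z
    rw [mulConj_apply, one_mul]
    rfl
  change polyDirac p q a (mulConj f g hf hg) = _
  rw [h1, h2, polyDirac_apply_mulConj, polyDirac_apply_mulConj, polyDirac_apply_mulConj,
    polyDerivAt_one, polyDerivAt_one, hp, hq', map_one, mul_one, one_mul]

/-! ### The support of p(∂)q(∂̄)δ_a -/

/-- The distributions that vanish on all functions vanishing near `a`. -/
def localAt (a : ℂ) : Submodule ℂ CompactDistribution where
  carrier := {w | ∀ φ : SmoothFun, (φ : ℂ → ℂ) =ᶠ[nhds a] 0 → w φ = 0}
  add_mem' {w w'} h h' φ hφ := by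
    change w φ + w' φ = 0
    rw [h φ hφ, h' φ hφ, add_zero]
  zero_mem' _ _ := rfl
  smul_mem' c w h φ hφ := by
    change c * w φ = 0
    rw [h φ hφ, mul_zero]

theorem dirac_mem_localAt (a : ℂ) : dirac a ∈ localAt a := fun _ hφ => hφ.self_of_nhds

theorem lineDeriv_mem_localAt (v : ℂ) {a : ℂ} {w : CompactDistribution} (hw : w ∈ localAt a) :
    lineDeriv v w ∈ localAt a := by
  intro φ hφ
  rw [lineDeriv_apply, hw, neg_zero]
  filter_upwards [hφ.fderiv (𝕜 := ℝ)] with z hz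
  change fderiv ℝ (φ : ℂ → ℂ) z v = 0
  rw [hz]
  simp

theorem aeval_mem {V : Submodule ℂ CompactDistribution} {T : Module.End ℂ CompactDistribution}
    (hT : ∀ w ∈ V, T w ∈ V) (p : ℂ[X]) {w : CompactDistribution} (hw : w ∈ V) :
    Polynomial.aeval T p w ∈ V := by
  have hn : ∀ n, (T ^ n) w ∈ V := by
    intro n
    induction n with
    | zero => simpa
    | succ n ih =>
      rw [pow_succ', Module.End.mul_apply]
      exact hT _ ih
  rw [Polynomial.aeval_eq_sum_range, LinearMap.sum_apply]
  exact V.sum_mem fun n _ => V.smul_mem _ (hn n)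

theorem polyDirac_mem_localAt (p q : ℂ[X]) (a : ℂ) : polyDirac p q a ∈ localAt a := by
  refine aeval_mem (fun w hw => ?_) p (aeval_mem (fun w hw => ?_) q (dirac_mem_localAt a))
  · exact Submodule.smul_mem _ _ (Submodule.sub_mem _ (lineDeriv_mem_localAt _ hw)
      (Submodule.smul_mem _ _ (lineDeriv_mem_localAt _ hw)))
  · exact Submodule.smul_mem _ _ (Submodule.add_mem _ (lineDeriv_mem_localAt _ hw)
      (Submodule.smul_mem _ _ (lineDeriv_mem_localAt _ hw)))

/-- Locality confines the support to {a}. The normalisation makes the pairing with 1 equal to 1, so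
a bump function equal to 1 near a has non-zero pairing however small its support. -/
theorem dsupport_polyDirac (p q : ℂ[X]) (hp : p.eval 0 = 1) (hq : q.eval 0 = 1) (a : ℂ) :
    Distribution.dsupport (polyDirac p q a) = {a} := by
  have hloc := polyDirac_mem_localAt p q a
  ext x
  rw [Set.mem_singleton_iff]
  constructor
  · intro hx
    by_contra hne
    refine (Distribution.notMem_dsupport_iff x).2 ⟨{a}ᶜ, fun φ hφ => hloc φ ?_,
      isOpen_compl_singleton, hne⟩ hx
    exact notMem_tsupport_iff_eventuallyEq.1 fun ha => hφ ha rfl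
  · rintro rfl
    refine (Distribution.mem_dsupport_iff_forall_exists_ne x).2 fun s hxs hs => ?_
    obtain ⟨ε, hε, hεs⟩ := Metric.isOpen_iff.1 hs x hxs
    let χ : ContDiffBump x := ⟨ε / 4, ε / 2, by linarith, by linarith⟩
    let φ : SmoothFun := ⟨fun z => (χ z : ℂ), Complex.ofRealCLM.contDiff.comp χ.contDiff⟩
    refine ⟨φ, ?_, ?_⟩
    · have h1 : tsupport (φ : ℂ → ℂ) ⊆ tsupport χ :=
        closure_mono fun z hz hχ => hz (by change (χ z : ℂ) = 0; simp [hχ])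
      rw [χ.tsupport_eq] at h1
      exact h1.trans ((Metric.closedBall_subset_ball (by simp only [χ]; linarith)).trans hεs)
    · have h1 := hloc (φ - mulConj (fun _ => 1) (fun _ => 1) (differentiable_const 1)
        (differentiable_const 1)) (by
          filter_upwards [χ.eventuallyEq_one] with z hz
          change (χ z : ℂ) - 1 * (starRingEnd ℂ) 1 = 0
          simp [hz])
      rw [map_sub, polyDirac_apply_one p q hp hq] at h1
      rw [sub_eq_zero.1 h1]
      exact one_ne_zero

end CompactDistribution
end

/-! ### Structure of non-zero weakly multiplicative distributions -/

noncomputable section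

namespace CompactDistribution
open SmoothFun

/-- Complex conjugation as a real-linear form. -/
def conjForm : ℂ →L[ℝ] ℂ := Complex.conjCLE.toContinuousLinearMap

/-- The coefficients are the Wirtinger derivatives of ℓ. Hence the two-parameter family exp(αz +
βz̄) contains all exponentials of real-linear forms. -/
theorem exists_eq_smul_id_add_smul_conj (ℓ : ℂ →L[ℝ] ℂ) :
    ∃ α β : ℂ, ℓ = α • ContinuousLinearMap.id ℝ ℂ + β • conjForm := by
  refine ⟨(ℓ 1 - Complex.I * ℓ Complex.I) / 2, (ℓ 1 + Complex.I * ℓ Complex.I) / 2, ?_⟩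
  ext z
  have hz : z = z.re • (1 : ℂ) + z.im • Complex.I := by simp
  have h1 : ℓ z = z.re * ℓ 1 + z.im * ℓ Complex.I := by
    conv_lhs => rw [hz]
    rw [map_add, map_smul, map_smul]
    simp
  have h2 : (starRingEnd ℂ) z = z.re - z.im * Complex.I := by
    apply Complex.ext <;> simp
  change ℓ z = (ℓ 1 - Complex.I * ℓ Complex.I) / 2 * z +
    (ℓ 1 + Complex.I * ℓ Complex.I) / 2 * (starRingEnd ℂ) z
  rw [h2, h1]
  nth_rw 3 [← Complex.re_add_im z]
  linear_combination (z.im * ℓ Complex.I) * Complex.I_mul_I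

theorem zero_smul_form (ℓ : ℂ →L[ℝ] ℂ) : (0 : ℂ) • ℓ = 0 :=
  ContinuousLinearMap.ext fun z => zero_mul (ℓ z)

theorem differentiable_cexp_mul (c : ℂ) : Differentiable ℂ fun z => Complex.exp (c * z) := by
  fun_prop

theorem expFun_eq_mulConj (α β : ℂ) :
    expFun (α • ContinuousLinearMap.id ℝ ℂ + β • conjForm) =
      mulConj (fun z => Complex.exp (α * z)) (fun z => Complex.exp ((starRingEnd ℂ) β * z))
        (differentiable_cexp_mul _) (differentiable_cexp_mul _) := by
  ext z
  rw [mulConj_apply, ← Complex.exp_conj, map_mul, Complex.conj_conj, ← Complex.exp_add]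
  rfl

theorem WeaklyMultiplicative.apply_expFun {u : CompactDistribution} (hu : u.WeaklyMultiplicative)
    (α β : ℂ) :
    u (expFun (α • ContinuousLinearMap.id ℝ ℂ + β • conjForm)) =
      u (expFun (α • ContinuousLinearMap.id ℝ ℂ)) * u (expFun (β • conjForm)) := by
  have h := hu _ _ (differentiable_cexp_mul α) (differentiable_cexp_mul ((starRingEnd ℂ) β))
  have h2 : (ofEntire _ (differentiable_cexp_mul ((starRingEnd ℂ) β))).conj =
      expFun (β • conjForm) := by
    ext z
    change (starRingEnd ℂ) (Complex.exp _) = Complex.exp (β * (starRingEnd ℂ) z)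
    rw [← Complex.exp_conj, map_mul, Complex.conj_conj]
  rw [expFun_eq_mulConj, ← h2]
  exact h

theorem polyDirac_apply_expFun (p q : ℂ[X]) (a α β : ℂ) :
    polyDirac p q a (expFun (α • ContinuousLinearMap.id ℝ ℂ + β • conjForm)) =
      p.eval (-α) * Complex.exp (α * a) *
        (q.eval (-β) * Complex.exp (β * (starRingEnd ℂ) a)) := by
  rw [expFun_eq_mulConj, polyDirac_apply_mulConj, polyDerivAt_exp, polyDerivAt_exp, map_mul,
    ← map_neg, Polynomial.eval_map_apply, Complex.conj_conj, ← Complex.exp_conj, map_mul,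
    Complex.conj_conj]

/-- A non-zero weakly multiplicative distribution is of the form `p(∂) q(∂̄) δ_a`. -/
theorem WeaklyMultiplicative.exists_eq_polyDirac {u : CompactDistribution}
    (hu : u.WeaklyMultiplicative) (h0 : u ≠ 0) :
    ∃ (a : ℂ) (p q : ℂ[X]), p.eval 0 = 1 ∧ q.eval 0 = 1 ∧ u = polyDirac p q a := by
  set A : ℂ → ℂ := fun α => u (expFun (α • ContinuousLinearMap.id ℝ ℂ)) with hA
  set B : ℂ → ℂ := fun β => u (expFun (β • conjForm)) with hB
  have hAB : ∀ α β, u (expFun (α • ContinuousLinearMap.id ℝ ℂ + β • conjForm)) = A α * B β :=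
    hu.apply_expFun
  have hA0 : A 0 = u (expFun 0) := by simp only [hA, zero_smul_form]
  have hB0 : B 0 = u (expFun 0) := by simp only [hB, zero_smul_form]
  -- ⟨u, 1⟩ is idempotent. If it were 0, then A(α) = A(α)B(0) = 0 for all α, so `u` would kill every
  -- exponential.
  have h1 : u (expFun 0) = 1 := by
    by_contra hne
    have hsq : u (expFun 0) = u (expFun 0) * u (expFun 0) := by
      have := hAB 0 0
      rwa [hA0, hB0, zero_smul_form, zero_smul_form, add_zero] at this
    have hz : u (expFun 0) = 0 := by
      by_contra hz
      exact hne (mul_left_cancel₀ hz (by rw [← hsq, mul_one]))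
    refine h0 (u.eq_zero_of_apply_expFun fun ℓ => ?_)
    obtain ⟨α, β, rfl⟩ := exists_eq_smul_id_add_smul_conj ℓ
    have hAα : A α = 0 := by
      have := hAB α 0
      rwa [hB0, hz, mul_zero, zero_smul_form, add_zero] at this
    rw [hAB, hAα, zero_mul]
  rw [h1] at hA0 hB0
  have hAd : Differentiable ℂ A := u.differentiable_apply_expFun_smul _
  have hBd : Differentiable ℂ B := u.differentiable_apply_expFun_smul _
  -- The outer conjugation makes H holomorphic while keeping |H(α)| = |B(-ᾱ)|.
  let H : ℂ → ℂ := fun α => (starRingEnd ℂ) (B (-(starRingEnd ℂ) α))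
  have hHd : Differentiable ℂ H := fun α => by
    have h := DifferentiableAt.conj_conj (f := fun β => B (-β)) (x := (starRingEnd ℂ) α)
      (hBd.comp differentiable_neg _)
    rwa [Complex.conj_conj] at h
  have hHg : HasExpGrowth H := by
    obtain ⟨C, D, hC, hD, h⟩ := u.hasExpGrowth_apply_expFun_smul conjForm
    refine ⟨C, D, hC, hD, fun α => ?_⟩
    have := h (-(starRingEnd ℂ) α)
    rw [norm_neg, RCLike.norm_conj] at this
    exact (RCLike.norm_conj _).trans_le this
  obtain ⟨C, N, R, hC, -, hb⟩ := u.exists_norm_apply_expFun_le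
  -- On β = -ᾱ the form has real part 0, so M = 0 is allowed; 2 ^ N comes from 1 + ‖ℓ‖ ≤ 2(1 + ‖α‖).
  obtain ⟨P, -, hP⟩ := exists_polynomial_of_norm_le (F := fun α => A α * H α) (C := C * 2 ^ N)
    (N := N) (hAd.mul hHd) (fun α => by
      set ℓ : ℂ →L[ℝ] ℂ := α • ContinuousLinearMap.id ℝ ℂ + (-(starRingEnd ℂ) α) • conjForm with hℓ
      have hℓz : ∀ z, ℓ z = α * z - (starRingEnd ℂ) (α * z) := by
        intro z
        rw [map_mul, sub_eq_add_neg, ← neg_mul]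
        rfl
      have hn : ‖ℓ‖ ≤ 2 * ‖α‖ := by
        refine ContinuousLinearMap.opNorm_le_bound _ (by positivity) fun z => ?_
        rw [hℓz]
        refine (norm_sub_le _ _).trans ?_
        rw [RCLike.norm_conj, norm_mul]
        linarith
      have h2 := hb ℓ 0 (fun z _ => by rw [hℓz]; simp)
      rw [hℓ, hAB, norm_mul, Real.exp_zero, one_mul] at h2
      rw [norm_mul, RCLike.norm_conj]
      refine h2.trans ?_
      rw [mul_assoc, ← mul_pow]
      gcongr
      linarith)
  have hH0 : H 0 = 1 := by simp [H, hB0]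
  have hP0 : P ≠ 0 := by
    rintro rfl
    have := hP 0
    simp [hA0, hH0] at this
  obtain ⟨p, q, a, hp, hq⟩ := exists_polynomial_mul_exp_of_mul_eq P hP0 A H hAd hHd
    (u.hasExpGrowth_apply_expFun_smul _) hHg hP
  have hBq : ∀ β, B β = (q.map (starRingEnd ℂ)).eval (-β) *
      Complex.exp (β * (starRingEnd ℂ) a) := by
    intro β
    have h2 := congrArg (starRingEnd ℂ) (hq (-(starRingEnd ℂ) β))
    simp only [H, map_neg, Complex.conj_conj, neg_neg, map_mul, ← Complex.exp_conj] at h2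
    have h3 : -β = (starRingEnd ℂ) (-(starRingEnd ℂ) β) := by simp
    rw [h2, h3, Polynomial.eval_map_apply, ← h3]
    congr 2
    ring
  -- Pairing p(∂)δ_a with exp(αz) evaluates p at -α, hence the substitution -X. For q the sign is
  -- already in the definition of H, and only the conjugation has to be undone.
  refine ⟨a, p.comp (-Polynomial.X), q.map (starRingEnd ℂ), ?_, ?_, ?_⟩
  · have := hp 0
    rw [hA0] at this
    simpa using this.symm
  · have := hBq 0
    rw [hB0] at this
    simpa using this.symm
  · rw [← sub_eq_zero]
    refine eq_zero_of_apply_expFun _ fun ℓ => ?_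
    obtain ⟨α, β, rfl⟩ := exists_eq_smul_id_add_smul_conj ℓ
    change u _ - polyDirac _ _ _ _ = 0
    rw [hAB, polyDirac_apply_expFun, hp, hBq]
    simp [mul_comm]

end CompactDistribution
end

theorem theorem1 (u : CompactDistribution) :
    (u.WeaklyMultiplicative ↔
      u = 0 ∨ ∃ (a : ℂ) (p q : ℂ[X]), p.eval 0 = 1 ∧ q.eval 0 = 1 ∧
        u = CompactDistribution.polyDirac p q a) ∧
    (∀ (a : ℂ) (p q : ℂ[X]), p.eval 0 = 1 → q.eval 0 = 1 →
      u = CompactDistribution.polyDirac p q a → Distribution.dsupport u = {a}) := by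
  refine ⟨⟨fun hu => or_iff_not_imp_left.2 hu.exists_eq_polyDirac, ?_⟩, ?_⟩
  · rintro (rfl | ⟨a, p, q, hp, hq, rfl⟩)
    · intro f g hf hg
      exact (zero_mul _).symm
    · exact CompactDistribution.weaklyMultiplicative_polyDirac p q hp hq a
  · rintro a p q hp hq rfl
    exact CompactDistribution.dsupport_polyDirac p q hp hq a
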